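/- Let $k$ be a field, $n\geqslant 1$ an integer, $E$ a $k$-vector space of dimension $n+1$, and let $\mathbb P(E)=\operatorname{Proj}(\operatorname{Sym}_k E)$ be the projective space over $k$ whose points with values in a commutative $k$-algebra $A$ are the quotient $A$-modules of $E\otimes_k A$ that are projective of rank $1$. Let $X$ be an integral closed subscheme of $\mathbb P(E)$, and let $X^{\mathrm{reg}}$ be the set of points $\xi\in X$ such that $\mathcal O_{X,\xi}$ is a regular local ring. If $X$ has a $k$-rational point lying in $X^{\mathrm{reg}}$, i.e. if there is a section $\operatorname{Spec} k\to X$ of the structure morphism $X\to\operatorname{Spec} k$ whose image lies in $X^{\mathrm{reg}}$, then $X$ is geometrically integral over $k$: for every field extension $k'/k$ the scheme $X\times_{\operatorname{Spec} k}\operatorname{Spec} k'$ is integral. -/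

import Mathlib

universe u

open CategoryTheory AlgebraicGeometry

namespace SymmetricAlgebra

open scoped DirectSum

variable (R M : Type*) [CommRing R] [AddCommGroup M] [Module R M]

/-- The homogeneous component of degree `n` of the symmetric algebra `Sym(M)`: the `R`-submodule
spanned by the products of `n` elements of `M`. -/
def homogeneousComponent (n : ℕ) : Submodule R (SymmetricAlgebra R M) :=
  LinearMap.range (ι R M) ^ n

/-- The canonical inclusion of `M` in degree one of the direct sum of the homogeneous components.
It is auxiliary to `SymmetricAlgebra.instGradedAlgebra`. -/
noncomputable def gradedι : M →ₗ[R] ⨁ n : ℕ, ↥(LinearMap.range (ι R M) ^ n) :=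
  DirectSum.lof R ℕ (fun n => ↥(LinearMap.range (ι R M) ^ n)) 1 ∘ₗ
    (ι R M).codRestrict _ fun m => by simpa only [pow_one] using LinearMap.mem_range_self _ m

theorem gradedι_apply (m : M) :
    gradedι R M m = DirectSum.of (fun n : ℕ => ↥(LinearMap.range (ι R M) ^ n)) 1
      ⟨ι R M m, by simpa only [pow_one] using LinearMap.mem_range_self _ m⟩ :=
  rfl

/-- The symmetric algebra is graded by the powers of the image of `M`. -/
noncomputable instance instGradedAlgebra : GradedAlgebra (homogeneousComponent R M) :=
  GradedAlgebra.ofAlgHom (fun n : ℕ => LinearMap.range (ι R M) ^ n) (lift (gradedι R M))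
    (by
      refine algHom_ext (LinearMap.ext fun m => ?_)
      change DirectSum.coeAlgHom _ (lift (gradedι R M) (ι R M m)) = ι R M m
      rw [lift_ι_apply, gradedι_apply R M, DirectSum.coeAlgHom_of])
    fun i x => by
    obtain ⟨x, hx⟩ := x
    dsimp only [Subtype.coe_mk, DirectSum.lof_eq_of]
    induction hx using Submodule.pow_induction_on_left' with
    | algebraMap r =>
      rw [AlgHom.commutes, DirectSum.algebraMap_apply]; rfl
    | add x y i hx hy ihx ihy =>
      rw [map_add, ihx, ihy, ← map_add]
      rfl
    | mem_mul m hm i x hx ih =>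
      obtain ⟨_, rfl⟩ := hm
      rw [map_mul, ih, lift_ι_apply, gradedι_apply R M, DirectSum.of_mul_of]
      exact DirectSum.of_eq_of_gradedMonoid_eq (Sigma.subtype_ext (add_comm _ _) rfl)

end SymmetricAlgebra

section ProjectiveSpace

variable (k E : Type u) [Field k] [AddCommGroup E] [Module k E]

/-- The projective space `ℙ(E) = Proj (Sym E)` of one-dimensional quotients of `E`. -/
noncomputable def projSpace : Scheme.{u} :=
  Proj (SymmetricAlgebra.homogeneousComponent k E)

/-- The structure morphism `ℙ(E) ⟶ Spec k`. -/
noncomputable def projSpaceToSpec : projSpace k E ⟶ Spec (.of k) :=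
  Proj.toSpecZero (SymmetricAlgebra.homogeneousComponent k E) ≫
    Spec.map (CommRingCat.ofHom
      (algebraMap k (SymmetricAlgebra.homogeneousComponent k E 0)))

end ProjectiveSpace

/-- The regular locus of a scheme: the points whose local ring is a regular local ring. -/
def regularLocus (X : Scheme.{u}) : Set X :=
  {x | IsRegularLocalRing (X.presheaf.stalk x)}

/-- The set `X^reg(k)` of regular `k`-rational points of a `k`-scheme `f : X ⟶ Spec k`: the sections
of `f` whose image lies in the regular locus of `X`. -/
def regularRationalPoints {k : Type u} [Field k] {X : Scheme.{u}} (f : X ⟶ Spec (.of k)) :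
    Set (Spec (.of k) ⟶ X) :=
  {s | s ≫ f = 𝟙 (Spec (.of k)) ∧ Set.range s ⊆ regularLocus X}

/-! Let `A` be the local ring of `X` at the rational point and `m` its maximal ideal. Since `A ⧸ m =
k`, the ideal `M = m(A ⊗[k] K)` is maximal for every field `K` over `k`. By flatness the
localization at `M` is regular, hence a domain. As `A ⊗[k] K` is free over `A`, Krull's `⨅ m ^ n =
⊥` gives `⨅ M ^ n = ⊥`; so elements outside `M` are nonzerodivisors and `A ⊗[k] K` embeds in that
domain (`IsRegularLocalRing.isDomain_of_free`). The map `Spec A ⟶ X` hits the generic point of the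
integral scheme `X`, so it is scheme-theoretically dominant, and so is its flat base change `Spec (A
⊗[k] K) ⟶ X_K`. Integrality passes from source to target. -/

/-! ### Regular local rings are domains -/

open IsLocalRing in
/-- A Noetherian local ring of positive dimension has an element of the maximal ideal `𝔪` outside
`𝔪 ^ 2` and outside all minimal primes. -/
theorem IsLocalRing.exists_mem_maximalIdeal_notMem_sq_notMem_minimalPrimes
    {R : Type*} [CommRing R] [IsLocalRing R] [IsNoetherianRing R] (h : 0 < ringKrullDim R) :
    ∃ x ∈ maximalIdeal R, x ∉ maximalIdeal R ^ 2 ∧ ∀ p ∈ minimalPrimes R, x ∉ p := by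
  classical
  by_contra! H
  have hfin := minimalPrimes.finite_of_isNoetherianRing R
  have hsub : (maximalIdeal R : Set R) ⊆
      ⋃ i ∈ (↑(insert (maximalIdeal R ^ 2) hfin.toFinset) : Set (Ideal R)), (id i : Ideal R) := by
    intro x hx
    by_cases hx2 : x ∈ maximalIdeal R ^ 2
    · exact Set.mem_biUnion (by simp) hx2
    · obtain ⟨p, hp, hxp⟩ := H x hx hx2
      exact Set.mem_biUnion (by simp [hp]) hxp
  -- Prime avoidance tolerates two non-prime ideals; `𝔪 ^ 2` fills both slots.
  obtain ⟨i, hi, hle⟩ := (Ideal.subset_union_prime (maximalIdeal R ^ 2) (maximalIdeal R ^ 2)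
    (fun i hi h _ => by
      rcases Finset.mem_insert.mp hi with rfl | hi
      · exact absurd rfl h
      · exact ((hfin.mem_toFinset.mp hi).1.1))).mp hsub
  have key : ∀ p ∈ minimalPrimes R, ¬ maximalIdeal R ≤ p := by
    intro p hp hle
    have : p.IsPrime := hp.1.1
    have hpm : maximalIdeal R = p := le_antisymm hle (le_maximalIdeal this.ne_top)
    rw [← maximalIdeal_height_eq_ringKrullDim, hpm, Ideal.height_eq_zero_iff.mpr hp] at h
    exact lt_irrefl _ h
  rcases Finset.mem_insert.mp hi with rfl | hi
  · have hbot : maximalIdeal R = ⊥ := by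
      refine Submodule.eq_bot_of_le_smul_of_le_jacobson_bot (maximalIdeal R) _
        (IsNoetherian.noetherian _) ?_ (maximalIdeal_le_jacobson _)
      simpa [pow_two] using hle
    obtain ⟨p, hp, -⟩ := Ideal.exists_minimalPrimes_le (bot_le : ⊥ ≤ maximalIdeal R)
    exact key p hp (hbot ▸ bot_le)
  · exact key i (hfin.mem_toFinset.mp hi) hle

open IsLocalRing in
/-- An element outside `𝔪 ^ 2` can be substituted for one of the generators of `𝔪`. -/
theorem IsLocalRing.exists_mem_span_insert_erase_eq_maximalIdeal
    {R : Type*} [CommRing R] [IsLocalRing R] [DecidableEq R] {s : Finset R}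
    (hs : Ideal.span (s : Set R) = maximalIdeal R) {x : R} (hx : x ∈ maximalIdeal R)
    (hx2 : x ∉ maximalIdeal R ^ 2) :
    ∃ g ∈ s, Ideal.span (insert x (s.erase g : Set R)) = maximalIdeal R := by
  obtain ⟨a, -, ha⟩ := Submodule.mem_span_finset.mp (hs ▸ hx : x ∈ Ideal.span (s : Set R))
  have : ∃ g ∈ s, IsUnit (a g) := by
    by_contra! H
    refine hx2 (ha ▸ Ideal.sum_mem _ fun g hg => ?_)
    rw [pow_two, smul_eq_mul]
    exact Ideal.mul_mem_mul ((mem_maximalIdeal _).mpr (H g hg)) (hs ▸ Ideal.subset_span hg)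
  obtain ⟨g, hg, hu⟩ := this
  refine ⟨g, hg, le_antisymm (Ideal.span_le.mpr ?_) (hs ▸ Ideal.span_le.mpr ?_)⟩
  · rintro y (rfl | hy)
    · exact hx
    · exact hs ▸ Ideal.subset_span (Finset.mem_of_mem_erase hy)
  · intro y hy
    by_cases hyg : y = g
    · subst hyg
      have hsum : a y * y = x - ∑ z ∈ s.erase y, a z * z := by
        rw [← ha, ← Finset.add_sum_erase _ _ hg]; simp
      have : a y * y ∈ Ideal.span (insert x (s.erase y : Set R)) := by
        rw [hsum]
        refine Ideal.sub_mem _ (Ideal.subset_span (Set.mem_insert _ _)) (Ideal.sum_mem _ fun z hz => ?_)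
        exact Ideal.mul_mem_left _ _ (Ideal.subset_span (Set.mem_insert_of_mem _ hz))
      exact (Ideal.unit_mul_mem_iff_mem _ hu).mp this
    · exact Ideal.subset_span (Set.mem_insert_of_mem _ (Finset.mem_erase.mpr ⟨hyg, hy⟩))

open IsLocalRing in
/-- A Noetherian local ring is a domain if some element of the maximal ideal lies in no minimal prime
and generates a prime ideal. -/
theorem IsLocalRing.isDomain_of_isPrime_span_singleton
    {R : Type*} [CommRing R] [IsLocalRing R] [IsNoetherianRing R] {x : R}
    (hx : x ∈ maximalIdeal R) (hmin : ∀ p ∈ minimalPrimes R, x ∉ p)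
    (hp : (Ideal.span {x}).IsPrime) : IsDomain R := by
  obtain ⟨p, hpmin, hple⟩ := Ideal.exists_minimalPrimes_le (bot_le : ⊥ ≤ Ideal.span {x})
  have hpp : p.IsPrime := hpmin.1.1
  -- If `z * x ∈ p` then `z ∈ p`, so `p ≤ 𝔪 • p` and Nakayama applies.
  have : p = ⊥ := by
    refine Submodule.eq_bot_of_le_smul_of_le_jacobson_bot (maximalIdeal R) _
      (IsNoetherian.noetherian _) ?_ (maximalIdeal_le_jacobson _)
    intro y hy
    obtain ⟨z, rfl⟩ := Ideal.mem_span_singleton'.mp (hple hy)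
    rw [mul_comm]
    exact Submodule.smul_mem_smul hx ((hpp.mem_or_mem hy).resolve_right (hmin p hpmin))
  subst this
  exact IsDomain.of_bot_isPrime R

-- Induction on the number of generators: dividing by a suitable `x` removes one generator and
-- lowers the dimension by at most one.
open IsLocalRing in
theorem IsLocalRing.isDomain_of_span_eq_maximalIdeal_of_card_le_ringKrullDim (n : ℕ) :
    ∀ {R : Type u} [CommRing R] [IsLocalRing R] [IsNoetherianRing R] (s : Finset R),
      s.card = n → Ideal.span (s : Set R) = maximalIdeal R → n ≤ ringKrullDim R → IsDomain R := by
  classical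
  induction n with
  | zero =>
    intro R _ _ _ s hn hs _
    obtain rfl := Finset.card_eq_zero.mp hn
    exact (isField_iff_maximalIdeal_eq.mpr (by simpa using hs.symm)).isDomain
  | succ n ih =>
    intro R _ _ _ s hn hs hdim
    obtain ⟨x, hx, hx2, hmin⟩ := exists_mem_maximalIdeal_notMem_sq_notMem_minimalPrimes
      (R := R) (lt_of_lt_of_le (by exact_mod_cast n.succ_pos) hdim)
    refine isDomain_of_isPrime_span_singleton hx hmin ?_
    obtain ⟨g, hg, hspan⟩ := exists_mem_span_insert_erase_eq_maximalIdeal hs hx hx2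
    have hne : Ideal.span {x} ≠ ⊤ := fun h =>
      (maximalIdeal.isMaximal R).ne_top (top_le_iff.mp (h ▸ (Ideal.span_singleton_le_iff_mem _).mpr hx))
    have : Nontrivial (R ⧸ Ideal.span {x}) := Ideal.Quotient.nontrivial_iff.mpr hne
    have hsurj := Ideal.Quotient.mk_surjective (I := Ideal.span {x})
    have : IsLocalRing (R ⧸ Ideal.span {x}) := IsLocalRing.of_surjective' _ hsurj
    have hmax : Ideal.span (((s.erase g).image (Ideal.Quotient.mk (Ideal.span {x})) :
        Finset (R ⧸ Ideal.span {x})) : Set (R ⧸ Ideal.span {x})) =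
        maximalIdeal (R ⧸ Ideal.span {x}) := by
      have hlocal : IsLocalHom (Ideal.Quotient.mk (Ideal.span {x})) := .of_surjective _ hsurj
      rw [← IsLocalRing.map_maximalIdeal_of_surjective _ hsurj, ← hspan, Ideal.map_span,
        Set.image_insert_eq, Ideal.Quotient.mk_singleton_self, Ideal.span_insert_zero,
        Finset.coe_image]
    obtain ⟨t, hts, hcard⟩ : ∃ t : Finset (R ⧸ Ideal.span {x}), Ideal.span (t : Set _) =
        maximalIdeal (R ⧸ Ideal.span {x}) ∧ t.card ≤ n :=
      ⟨_, hmax, Finset.card_image_le.trans (by rw [Finset.card_erase_of_mem hg, hn]; simp)⟩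
    have hdim' : (n : WithBot ℕ∞) ≤ ringKrullDim (R ⧸ Ideal.span {x}) := by
      have h1 := ringKrullDim_le_ringKrullDim_quotient_add_encard {x} (R := R)
        (by rw [← Ideal.jacobson_bot, Set.singleton_subset_iff]; exact maximalIdeal_le_jacobson ⊥ hx)
      have h2 := hdim.trans h1
      simp only [Set.encard_singleton] at h2
      push_cast at h2
      exact (ENat.WithBot.add_le_add_one_right_iff).mp h2
    -- Generators might coincide in the quotient; the dimension bound forces `t.card = n`.
    have hle : ringKrullDim (R ⧸ Ideal.span {x}) ≤ t.card := by
      have h1 := ringKrullDim_le_spanFinrank_maximalIdeal (R := R ⧸ Ideal.span {x})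
      rw [← hts] at h1
      refine h1.trans ?_
      have := Submodule.spanFinrank_span_le_ncard_of_finite (R := R ⧸ Ideal.span {x})
        t.finite_toSet
      rw [Set.ncard_coe_finset] at this
      exact_mod_cast this
    have : IsDomain (R ⧸ Ideal.span {x}) :=
      ih t (le_antisymm hcard (by exact_mod_cast hdim'.trans hle)) hts hdim'
    exact (Ideal.Quotient.isDomain_iff_prime _).mp this

open IsLocalRing in
instance IsRegularLocalRing.isDomain (R : Type u) [CommRing R] [IsRegularLocalRing R] :
    IsDomain R := by
  obtain ⟨s, hs, hspan⟩ := 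
    Submodule.FG.exists_span_finset_card_eq_spanFinrank (maximalIdeal R).fg_of_isNoetherianRing
  exact isDomain_of_span_eq_maximalIdeal_of_card_le_ringKrullDim _ s hs hspan
    IsRegularLocalRing.spanFinrank_maximalIdeal.le

/-! ### Base change of a regular local ring with a rational point -/

section

open TensorProduct IsLocalRing

theorem Ideal.basis_repr_mem_of_mem_map {A B ι : Type*} [CommRing A] [CommRing B] [Algebra A B]
    (b : Module.Basis ι A B) {I : Ideal A} {z : B} (hz : z ∈ I.map (algebraMap A B)) (i : ι) :
    b.repr z i ∈ I := by
  have hz' : z ∈ I • (⊤ : Submodule A B) := by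
    rwa [Ideal.smul_top_eq_map, Submodule.restrictScalars_mem]
  refine Submodule.smul_induction_on hz' (fun r hr n _ => ?_) fun x y hx hy => ?_
  · simpa using I.mul_mem_right _ hr
  · simpa using I.add_mem hx hy

theorem Ideal.iInf_map_pow_eq_bot {A B : Type*} [CommRing A] [CommRing B] [Algebra A B]
    [Module.Free A B] {I : Ideal A} (hI : ⨅ n : ℕ, I ^ n = ⊥) :
    ⨅ n : ℕ, I.map (algebraMap A B) ^ n = ⊥ := by
  refine eq_bot_iff.mpr fun z hz => ?_
  rw [Submodule.mem_iInf] at hz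
  let b := Module.Free.chooseBasis A B
  refine b.repr.map_eq_zero_iff.mp (Finsupp.ext fun i => ?_)
  have : b.repr z i ∈ ⨅ n : ℕ, I ^ n := (Submodule.mem_iInf _).mpr fun n =>
    basis_repr_mem_of_mem_map b (by rw [Ideal.map_pow]; exact hz n) i
  rw [hI] at this
  exact this

/-- For `s ∉ M` write `1 = t * s + m` with `m ∈ M`; if `a * s = 0` then `a = m ^ n * a` for all `n`.
-/
theorem Ideal.primeCompl_le_nonZeroDivisors_of_iInf_pow_eq_bot {B : Type*} [CommRing B]
    (M : Ideal B) [M.IsMaximal] (hM : ⨅ n : ℕ, M ^ n = ⊥) :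
    M.primeCompl ≤ nonZeroDivisors B := by
  refine fun s hs => mem_nonZeroDivisors_iff_right.mpr fun a ha => ?_
  obtain ⟨t, m, hm, hts⟩ := Ideal.IsMaximal.exists_inv ‹M.IsMaximal› hs
  have hma : m * a = a := by linear_combination a * hts - t * ha
  have hpow : ∀ n : ℕ, m ^ n * a = a := fun n => by
    induction n with
    | zero => simp
    | succ n ih => rw [pow_succ, mul_assoc, hma, ih]
  have : a ∈ ⨅ n : ℕ, M ^ n := (Submodule.mem_iInf _).mpr fun n =>
    hpow n ▸ Ideal.mul_mem_right _ _ (Ideal.pow_mem_pow hm n)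
  rwa [hM] at this

/-- Regularity ascends along a flat morphism with reduced point fibre. -/
theorem IsRegularLocalRing.localization_map_maximalIdeal {A B : Type u} [CommRing A]
    [IsRegularLocalRing A] [CommRing B] [IsNoetherianRing B] [Algebra A B] [Module.Flat A B]
    (M : Ideal B) [M.IsMaximal] (hM : (maximalIdeal A).map (algebraMap A B) = M) :
    IsRegularLocalRing (Localization.AtPrime M) := by
  refine IsRegularLocalRing.of_spanFinrank_maximalIdeal_le _ ?_
  have hover : M.LiesOver (maximalIdeal A) := ⟨by
    refine (maximalIdeal.isMaximal A).eq_of_le (Ideal.IsPrime.under A M).ne_top ?_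
    exact Ideal.map_le_iff_le_comap.mp hM.le⟩
  -- Going-down for flat maps bounds the dimension below by `dim A`, and `dim A` elements generate.
  have hheight : (maximalIdeal A).height ≤ M.height := by
    rw [Ideal.height_eq_height_add_of_liesOver_of_hasGoingDown (maximalIdeal A) M]
    exact le_self_add
  rw [IsLocalization.AtPrime.ringKrullDim_eq_height M,
    ← Localization.AtPrime.map_eq_maximalIdeal,
    show M.map (algebraMap B (Localization.AtPrime M)) = _ from
      congrArg (Ideal.map _) hM.symm, Ideal.map_map]
  refine le_trans ?_ (WithBot.coe_le_coe.mpr hheight)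
  rw [maximalIdeal_height_eq_ringKrullDim, ← IsRegularLocalRing.spanFinrank_maximalIdeal]
  exact_mod_cast Ideal.spanFinrank_map_le_of_fg _ (maximalIdeal A).fg_of_isNoetherianRing

theorem IsRegularLocalRing.isDomain_of_free {A B : Type u} [CommRing A]
    [IsRegularLocalRing A] [CommRing B] [IsNoetherianRing B] [Algebra A B] [Module.Free A B]
    (hM : ((maximalIdeal A).map (algebraMap A B)).IsMaximal) : IsDomain B := by
  have := localization_map_maximalIdeal _ (hM := rfl) (A := A) (B := B)
  have hle := Ideal.primeCompl_le_nonZeroDivisors_of_iInf_pow_eq_bot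
    ((maximalIdeal A).map (algebraMap A B)) (Ideal.iInf_map_pow_eq_bot
      (Ideal.iInf_pow_eq_bot_of_isLocalRing _ (maximalIdeal.isMaximal A).ne_top))
  exact (IsLocalization.injective
    (Localization.AtPrime ((maximalIdeal A).map (algebraMap A B))) hle).isDomain (algebraMap B _)

theorem AlgHom.isMaximal_map_ker_tensorProduct {k A K : Type*} [Field k] [CommRing A]
    [Algebra k A] [Field K] [Algebra k K] (φ : A →ₐ[k] k) :
    ((RingHom.ker φ).map (algebraMap A (A ⊗[k] K))).IsMaximal := by
  have hφ : Function.Surjective φ := fun x => ⟨algebraMap k A x, by simp⟩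
  have h := Algebra.TensorProduct.rTensor_ker (R := k) (C := K) φ hφ
  let ψ : A ⊗[k] K →ₐ[k] K := (Algebra.TensorProduct.lid k K).toAlgHom.comp
    (Algebra.TensorProduct.map φ (AlgHom.id k K))
  have hψ : Function.Surjective ψ := fun y => ⟨1 ⊗ₜ y, by simp [ψ]⟩
  have hker : RingHom.ker ψ = (RingHom.ker φ).map (algebraMap A (A ⊗[k] K)) := by
    refine Eq.trans ?_ h
    ext z
    simp [ψ, RingHom.mem_ker]
  rw [← hker]
  exact RingHom.ker_isMaximal_of_surjective ψ hψ

/-- The base change to any field of a regular local `k`-algebra essentially of finite type with a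
`k`-rational closed point is a domain. -/
theorem IsRegularLocalRing.isDomain_tensorProduct {k A K : Type u} [Field k] [CommRing A]
    [Algebra k A] [Algebra.EssFiniteType k A] [IsRegularLocalRing A] [Field K] [Algebra k K]
    (φ : A →ₐ[k] k) : IsDomain (A ⊗[k] K) := by
  have : IsNoetherianRing (K ⊗[k] A) := Algebra.EssFiniteType.isNoetherianRing K _
  have : IsNoetherianRing (A ⊗[k] K) :=
    isNoetherianRing_of_ringEquiv _ (Algebra.TensorProduct.comm k K A).toRingEquiv
  have hφ : Function.Surjective φ := fun x => ⟨algebraMap k A x, by simp⟩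
  have hker : RingHom.ker φ = maximalIdeal A :=
    eq_maximalIdeal (RingHom.ker_isMaximal_of_surjective φ hφ)
  exact isDomain_of_free (A := A) (hker ▸ φ.isMaximal_map_ker_tensorProduct)

end

/-! ### From the local ring to the scheme -/

section

open Limits TensorProduct

theorem AlgebraicGeometry.isIntegral_of_isSchemeTheoreticallyDominant {X Y : Scheme.{u}}
    (f : X ⟶ Y) [IsSchemeTheoreticallyDominant f] [QuasiCompact f] [IsIntegral X] :
    IsIntegral Y := by
  have : IsReduced Y := IsSchemeTheoreticallyDominant.isReduced f
  have hd : DenseRange f := IsDominant.denseRange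
  have : IrreducibleSpace Y := by
    rw [irreducibleSpace_def, Set.top_eq_univ, ← hd.closure_range, isIrreducible_iff_closure,
      ← Set.image_univ]
    exact (IrreducibleSpace.isIrreducible_univ X).image _ f.continuous.continuousOn
  exact isIntegral_of_irreducibleSpace_of_isReduced Y

theorem AlgebraicGeometry.Scheme.isDominant_fromSpecStalk (X : Scheme.{u}) [IrreducibleSpace X]
    (x : X) : IsDominant (X.fromSpecStalk x) := by
  refine ⟨?_⟩
  have hg : genericPoint X ∈ Set.range (X.fromSpecStalk x) := by
    rw [Scheme.range_fromSpecStalk]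
    exact genericPoint_specializes x
  refine dense_iff_closure_eq.mpr (Set.eq_univ_of_univ_subset ?_)
  rw [← genericPoint_closure (α := X)]
  exact closure_mono (Set.singleton_subset_iff.mpr hg)

theorem AlgebraicGeometry.geometricallyIntegral_of_isDomain_stalk_tensorProduct {k : Type u}
    [Field k] {X : Scheme.{u}} [IsIntegral X] [X.IsSeparated] (f : X ⟶ Spec (.of k)) (x : X)
    [Algebra k (X.presheaf.stalk x)]
    (hf : X.fromSpecStalk x ≫ f =
      Spec.map (CommRingCat.ofHom (algebraMap k (X.presheaf.stalk x))))
    (h : ∀ (K : Type u) [Field K] [Algebra k K], IsDomain (X.presheaf.stalk x ⊗[k] K)) :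
    GeometricallyIntegral f := by
  refine ⟨geometrically_iff_of_commRing.mpr fun K _ _ Z fst snd hZ => ?_⟩
  have := h K
  have := X.isDominant_fromSpecStalk x
  have : IsSchemeTheoreticallyDominant (X.fromSpecStalk x) := .of_isDominant _
  have : Flat fst := MorphismProperty.of_isPullback hZ.flip inferInstance
  let g := pullback.fst fst (X.fromSpecStalk x)
  have : IsIntegral (pullback fst (X.fromSpecStalk x)) := by
    have h1 := ((IsPullback.of_hasPullback fst (X.fromSpecStalk x)).paste_horiz hZ.flip).flip
    rw [hf] at h1
    have h2 := isPullback_SpecMap_of_isPushout _ _ _ _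
      (CommRingCat.isPushout_tensorProduct k (X.presheaf.stalk x) K)
    have : IsIntegral (Spec (.of (X.presheaf.stalk x ⊗[k] K))) := inferInstance
    have : Nonempty (pullback fst (X.fromSpecStalk x) : Scheme.{u}) :=
      ⟨(h2.isoIsPullback _ _ h1).hom (Nonempty.some inferInstance)⟩
    exact isIntegral_of_isOpenImmersion (h1.isoIsPullback _ _ h2).hom
  exact isIntegral_of_isSchemeTheoreticallyDominant g


/-- The stalk localizes a finite type coordinate ring; this later makes `A ⊗[k] K` Noetherian. -/
theorem AlgebraicGeometry.essFiniteType_of_specMap_eq_fromSpecStalk_comp {R : CommRingCat.{u}}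
    {X : Scheme.{u}} (f : X ⟶ Spec R) [LocallyOfFiniteType f] (x : X)
    (ψ : R ⟶ X.presheaf.stalk x) (hψ : Spec.map ψ = X.fromSpecStalk x ≫ f) :
    ψ.hom.EssFiniteType := by
  obtain ⟨U, hU, hxU, -⟩ := exists_isAffineOpen_mem_and_subset (TopologicalSpace.Opens.mem_top x)
  obtain ⟨θ, hθ⟩ := Spec.map_surjective (hU.fromSpec ≫ f)
  have hft : LocallyOfFiniteType (Spec.map θ) := hθ ▸ inferInstance
  rw [HasRingHomProperty.Spec_iff (P := @LocallyOfFiniteType)] at hft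
  have hcomp : ψ = θ ≫ X.presheaf.germ U x hxU := by
    refine Spec.map_injective ?_
    rw [Spec.map_comp, hψ, hθ, ← hU.fromSpecStalk_eq_fromSpecStalk hxU,
      IsAffineOpen.fromSpecStalk, Category.assoc]
  have hgerm : (X.presheaf.germ U x hxU).hom.EssFiniteType := by
    let := (X.presheaf.germ U x hxU).hom.toAlgebra
    have := hU.isLocalization_stalk ⟨x, hxU⟩
    exact .of_isLocalization _ (hU.primeIdealOf ⟨x, hxU⟩).asIdeal.primeCompl
  rw [hcomp, CommRingCat.hom_comp]
  exact hft.essFiniteType.comp hgerm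

theorem AlgebraicGeometry.exists_stalk_retraction {k : Type u} [Field k] {X : Scheme.{u}}
    (f : X ⟶ Spec (.of k)) [LocallyOfFiniteType f] (s : Spec (.of k) ⟶ X) (hs : s ≫ f = 𝟙 _) :
    ∃ (x : X) (_ : x ∈ Set.range s) (_ : Algebra k (X.presheaf.stalk x)),
      Algebra.EssFiniteType k (X.presheaf.stalk x) ∧ 
      X.fromSpecStalk x ≫ f =
        Spec.map (CommRingCat.ofHom (algebraMap k (X.presheaf.stalk x))) ∧
      Nonempty (X.presheaf.stalk x →ₐ[k] k) := by
  let x := s (IsLocalRing.closedPoint k)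
  obtain ⟨ψ, hψ⟩ := Spec.map_surjective (X.fromSpecStalk x ≫ f)
  refine ⟨x, ⟨_, rfl⟩, ψ.hom.toAlgebra, ?_, hψ.symm, ⟨?_⟩⟩
  · exact essFiniteType_of_specMap_eq_fromSpecStalk_comp f x ψ hψ
  · have hcomp : ψ ≫ Scheme.stalkClosedPointTo s = 𝟙 _ := by
      refine Spec.map_injective ?_
      rw [Spec.map_comp, hψ, Spec.map_id, ← Category.assoc,
        Scheme.Spec_stalkClosedPointTo_fromSpecStalk, hs]
    let _ := ψ.hom.toAlgebra
    refine ⟨(Scheme.stalkClosedPointTo s).hom, fun r => ?_⟩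
    exact congr($(hcomp).hom r)

end

/-! ### Projective space and the main theorem -/

theorem SymmetricAlgebra.algebraMap_homogeneousComponent_zero_surjective (R M : Type*)
    [CommRing R] [AddCommGroup M] [Module R M] :
    Function.Surjective (algebraMap R (homogeneousComponent R M 0)) := by
  rintro ⟨y, hy⟩
  rw [homogeneousComponent, pow_zero] at hy
  obtain ⟨r, rfl⟩ := Submodule.mem_one.mp hy
  exact ⟨r, rfl⟩

theorem locallyOfFiniteType_projSpaceToSpec (k E : Type u) [Field k] [AddCommGroup E] [Module k E]
    [Module.Finite k E] : LocallyOfFiniteType (projSpaceToSpec k E) := by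
  have : Algebra.FiniteType k (SymmetricAlgebra k E) :=
    Algebra.FiniteType.equiv inferInstance
      (SymmetricAlgebra.equivMvPolynomial (Module.Free.chooseBasis k E)).symm
  have : IsScalarTower k (SymmetricAlgebra.homogeneousComponent k E 0) (SymmetricAlgebra k E) :=
    IsScalarTower.of_algebraMap_eq (R := k) (S := SymmetricAlgebra.homogeneousComponent k E 0)
      (A := SymmetricAlgebra k E) fun _ => rfl
  have : Algebra.FiniteType (SymmetricAlgebra.homogeneousComponent k E 0) (SymmetricAlgebra k E) :=
    Algebra.FiniteType.of_restrictScalars_finiteType k _ _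
  have : LocallyOfFiniteType (Spec.map (CommRingCat.ofHom
      (algebraMap k (SymmetricAlgebra.homogeneousComponent k E 0)))) := by
    rw [HasRingHomProperty.Spec_iff (P := @LocallyOfFiniteType)]
    exact RingHom.FiniteType.of_surjective _
      (SymmetricAlgebra.algebraMap_homogeneousComponent_zero_surjective k E)
  exact locallyOfFiniteType_comp (Proj.toSpecZero (SymmetricAlgebra.homogeneousComponent k E)) _

instance isSeparated_projSpace (k E : Type u) [Field k] [AddCommGroup E] [Module k E] :
    (projSpace k E).IsSeparated := by
  unfold projSpace; infer_instance

theorem mainTheorem7 {k : Type u} [Field k] {E : Type u} [AddCommGroup E] [Module k E]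
    (n : ℕ) (hn : 1 ≤ n) (hE : Module.finrank k E = n + 1)
    {X : Scheme.{u}} [IsIntegral X] (i : X ⟶ projSpace k E) [IsClosedImmersion i]
    (hX : (regularRationalPoints (i ≫ projSpaceToSpec k E)).Nonempty) :
    GeometricallyIntegral (i ≫ projSpaceToSpec k E) := by
  have : Module.Finite k E := Module.finite_of_finrank_pos (hE ▸ n.succ_pos)
  have := locallyOfFiniteType_projSpaceToSpec k E
  -- Separatedness makes the map from the spectrum of a stalk to `X` quasi-compact.
  have : X.IsSeparated := ⟨Limits.terminal.comp_from i ▸ inferInstance⟩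
  obtain ⟨s, hs, hreg⟩ := hX
  obtain ⟨x, hx, _, _, hf, ⟨φ⟩⟩ := exists_stalk_retraction (i ≫ projSpaceToSpec k E) s hs
  have : IsRegularLocalRing (X.presheaf.stalk x) := hreg hx
  exact geometricallyIntegral_of_isDomain_stalk_tensorProduct _ x hf
    fun _ _ _ => IsRegularLocalRing.isDomain_tensorProduct φ
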